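/- Let $F_n$ and $L_n$ ($n\in\mathbb Z$) be the Fibonacci and Lucas numbers: $F_0=0$, $F_1=1$, $L_0=2$, $L_1=1$, $X_n=X_{n-1}+X_{n-2}$ for $n\ge 2$, and $F_{-j}=(-1)^{j-1}F_j$, $L_{-j}=(-1)^jL_j$. Let $\alpha=(1+\sqrt5)/2$, $\beta=(1-\sqrt5)/2$, and let $\sqrt[3]{x}$ denote the real cube root of a real number $x$ of either sign. Let $p$ and $q$ be integers with $p\le -2$, $q\ge 4$ and $q>|p|+1$, and for $s\in\{\alpha,\beta\}$ put $$A^{\pm}_s=\sqrt[3]{s^q}\,\frac{\sqrt[3]{s^qF_p}\pm\sqrt[3]{F_{p+q}}}{s^qF_p+F_{p+q}}.$$ Then the following two series converge (absolutely), and $$\begin{aligned} \frac{\sqrt5}{\sqrt[3]{F_pF_{p+q}}}&\sum_{k=1}^\infty\Big(\frac{-27F_pF_{p+q}}{F_q^2}\Big)^{k}\frac{F_{(2p+q)k}}{k\binom{3k}{k}}\\ &=2\sqrt3\left(A^-_\alpha\arctan\Big(\frac{\sqrt3\,\sqrt[3]{F_{p+q}}}{2\sqrt[3]{\alpha^qF_p}+\sqrt[3]{F_{p+q}}}\Big)+A^-_\beta\arctan\Big(\frac{\sqrt3\,\sqrt[3]{F_p}}{2(-1)^q\sqrt[3]{\alpha^qF_{p+q}}+\sqrt[3]{F_p}}\Big)\right)\\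 &\quad-\left(A^+_\alpha\log\Big(\frac{\beta^pF_q}{\big(\sqrt[3]{F_{p+q}}-\sqrt[3]{\alpha^qF_p}\big)^3}\Big)-A^+_\beta\log\Big(\frac{\alpha^pF_q}{\big(\sqrt[3]{F_{p+q}}-\sqrt[3]{\beta^qF_p}\big)^3}\Big)\right), \end{aligned}$$ $$\begin{aligned} \frac{1}{\sqrt[3]{F_pF_{p+q}}}&\sum_{k=1}^\infty\Big(\frac{-27F_pF_{p+q}}{F_q^2}\Big)^{k}\frac{L_{(2p+q)k}}{k\binom{3k}{k}}\\ &=2\sqrt3\left(A^-_\alpha\arctan\Big(\frac{\sqrt3\,\sqrt[3]{F_{p+q}}}{2\sqrt[3]{\alpha^qF_p}+\sqrt[3]{F_{p+q}}}\Big)-A^-_\beta\arctan\Big(\frac{\sqrt3\,\sqrt[3]{F_p}}{2(-1)^q\sqrt[3]{\alpha^qF_{p+q}}+\sqrt[3]{F_p}}\Big)\right)\\ &\quad-\left(A^+_\alpha\log\Big(\frac{\beta^pF_q}{\big(\sqrt[3]{F_{p+q}}-\sqrt[3]{\alpha^qF_p}\big)^3}\Big)+A^+_\beta\log\Big(\frac{\alpha^pF_q}{\big(\sqrt[3]{F_{p+q}}-\sqrt[3]{\beta^qF_p}\big)^3}\Big)\right).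 \end{aligned}$$ -/

import Mathlib

open scoped goldenRatio

namespace FibLucasSeries

/-- The Lucas numbers with natural index: `2, 1, 3, 4, 7, 11, …`. -/
def lucasNat : ℕ → ℤ
  | 0 => 2
  | 1 => 1
  | n + 2 => lucasNat n + lucasNat (n + 1)

/-- The Lucas numbers with integer index, with `L_{-j} = (-1)^j L_j`.
The Fibonacci numbers with integer index are `Int.fib`. -/
def lucas : ℤ → ℤ
  | Int.ofNat n => lucasNat n
  | Int.negSucc n => (-1) ^ (n + 1) * lucasNat (n + 1)

/-- The real cube root of a real number of either sign. -/
noncomputable def cbrt (x : ℝ) : ℝ :=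
  if 0 ≤ x then x ^ (1 / 3 : ℝ) else -((-x) ^ (1 / 3 : ℝ))

/-- The coefficient `(-27 F_p F_{p+q} / F_q^2)^k / (k * binom(3k, k))` (used for `k ≥ 1`). -/
noncomputable def coeff (p q : ℤ) (k : ℕ) : ℝ :=
  (-27 * (Int.fib p : ℝ) * (Int.fib (p + q) : ℝ) / (Int.fib q : ℝ) ^ 2) ^ k /
    ((k : ℝ) * ((3 * k).choose k : ℝ))

/-- The weight `A_s^+`. -/
noncomputable def Aplus (p q : ℤ) (s : ℝ) : ℝ :=
  cbrt (s ^ q) * ((cbrt (s ^ q * Int.fib p) + cbrt (Int.fib (p + q))) /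
    (s ^ q * Int.fib p + Int.fib (p + q)))

/-- The weight `A_s^-`. -/
noncomputable def Aminus (p q : ℤ) (s : ℝ) : ℝ :=
  cbrt (s ^ q) * ((cbrt (s ^ q * Int.fib p) - cbrt (Int.fib (p + q))) /
    (s ^ q * Int.fib p + Int.fib (p + q)))

end FibLucasSeries

namespace FibLucasSeries

open Real intervalIntegral

/-! The beta integral turns 1/(k binom(3k,k)) into ∫₀¹ z^(2k) (1-z)^(k-1) dz. Summing a geometric
series under the integral gives ∑ x^k/(k binom(3k,k)) = ∫₀¹ x z²/(1 - x z²(1-z)) dz for |x| < 27/4.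
Put x = -27t³/(1-t³)². Then the cubic denominator factors rationally in t (`one_sub_cubic_eq`), and
partial fractions give one logarithm and one arctangent (`integral_eq_closedForm`). For Fibonacci
numbers, take a³ = s^q F_p and b³ = F_{p+q} with s = φ or ψ. By Binet, b³ - a³ = s'^p F_q, where s'
is the conjugate of s. Since (s s')² = 1, the argument of the series along powers of s is
-27a³b³/(b³-a³)², so t is b/a or a/b, whichever is smaller in modulus: b/a for φ, a/b for ψ.
`fib_ratio_bounds` gives convergence. The difference and the sum of the two evaluations are the
Fibonacci and Lucas series. -/

/-! ### The series as an integral -/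

/-- Euler's beta integral at natural exponents. -/
theorem integral_pow_mul_one_sub_pow (n m : ℕ) :
    ∫ z in (0 : ℝ)..1, z ^ m * (1 - z) ^ n =
      (m.factorial * n.factorial : ℝ) / (m + n + 1).factorial := by
  induction n generalizing m with
  | zero =>
    simp only [pow_zero, mul_one, integral_pow, Nat.factorial_zero, Nat.cast_one, add_zero,
      Nat.factorial_succ, Nat.cast_mul, one_pow]
    have := Nat.factorial_pos m
    push_cast
    field_simp
    simp
  | succ n ih =>
    -- Integration by parts: the integrand is the derivative of z^(m+1) (1-z)^(n+1), which vanishes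
    -- at both ends.
    have key : ∫ z in (0 : ℝ)..1, ((m + 1 : ℝ) * (z ^ m * (1 - z) ^ (n + 1)) -
        (n + 1) * (z ^ (m + 1) * (1 - z) ^ n)) = 0 := by
      rw [integral_eq_sub_of_hasDerivAt (f := fun z : ℝ => z ^ (m + 1) * (1 - z) ^ (n + 1))]
      · simp
      · intro z _
        have h1 : HasDerivAt (fun z : ℝ => z ^ (m + 1)) ((m + 1 : ℝ) * z ^ m) z := by
          simpa using hasDerivAt_pow (m + 1) z
        have h2 : HasDerivAt (fun z : ℝ => (1 - z) ^ (n + 1)) (-((n + 1 : ℝ) * (1 - z) ^ n)) z := by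
          simpa using ((hasDerivAt_id z).const_sub 1).fun_pow (n + 1)
        convert! h1.mul h2 using 1
        ring
      · apply Continuous.intervalIntegrable
        fun_prop
    rw [integral_sub (by apply Continuous.intervalIntegrable; fun_prop)
      (by apply Continuous.intervalIntegrable; fun_prop), integral_const_mul, integral_const_mul,
      ih, show m + 1 + n + 1 = m + (n + 1) + 1 by ring] at key
    have h3 := Nat.factorial_pos (m + (n + 1) + 1)
    have h4 : (m + 1 : ℝ) ≠ 0 := by positivity
    apply mul_left_cancel₀ h4
    rw [sub_eq_zero.mp key, Nat.factorial_succ m, Nat.factorial_succ n]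
    push_cast
    ring

theorem integral_eq_inv_mul_choose (k : ℕ) :
    ∫ z in (0 : ℝ)..1, z ^ (2 * (k + 1)) * (1 - z) ^ k =
      1 / (((k + 1 : ℕ) : ℝ) * ((3 * (k + 1)).choose (k + 1) : ℝ)) := by
  rw [integral_pow_mul_one_sub_pow, Nat.cast_choose ℝ (by omega : k + 1 ≤ 3 * (k + 1)),
    show 3 * (k + 1) - (k + 1) = 2 * (k + 1) by omega,
    show 2 * (k + 1) + k + 1 = 3 * (k + 1) by omega, Nat.factorial_succ k]
  have h1 := Nat.factorial_pos k
  have h2 := Nat.factorial_pos (2 * (k + 1))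
  have h3 := Nat.factorial_pos (3 * (k + 1))
  push_cast
  field_simp

/-- The gap 4/27 - z²(1-z) equals (z + 1/3)(z - 2/3)²; this is the source of the radius 27/4. -/
theorem sq_mul_one_sub_le {z : ℝ} (h0 : 0 ≤ z) : z ^ 2 * (1 - z) ≤ 4 / 27 := by
  nlinarith [mul_nonneg (by linarith : (0 : ℝ) ≤ z + 1 / 3) (sq_nonneg (z - 2 / 3))]

theorem abs_mul_sq_mul_one_sub_le {x z : ℝ} (h : z ∈ Set.Icc (0 : ℝ) 1) :
    |x * (z ^ 2 * (1 - z))| ≤ 4 * |x| / 27 := by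
  have h2 : 0 ≤ z ^ 2 * (1 - z) := mul_nonneg (sq_nonneg z) (by linarith [h.2])
  rw [abs_mul, abs_of_nonneg h2]
  nlinarith [sq_mul_one_sub_le h.1, abs_nonneg x]

/-- Integral representation of the series with coefficients `1 / (k * binom(3k, k))`. -/
theorem hasSum_integral {x : ℝ} (hx : 4 * |x| < 27) :
    HasSum (fun k : ℕ => x ^ (k + 1) / (((k + 1 : ℕ) : ℝ) * ((3 * (k + 1)).choose (k + 1) : ℝ)))
      (∫ z in (0 : ℝ)..1, x * z ^ 2 / (1 - x * (z ^ 2 * (1 - z)))) := by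
  set r := 4 * |x| / 27 with hr
  have hr0 : 0 ≤ r := by positivity
  have hr1 : r < 1 := by rw [hr]; linarith
  have hterm : ∀ k : ℕ,
      x ^ (k + 1) / (((k + 1 : ℕ) : ℝ) * ((3 * (k + 1)).choose (k + 1) : ℝ)) =
      ∫ z in (0 : ℝ)..1, x * z ^ 2 * (x * (z ^ 2 * (1 - z))) ^ k := by
    intro k
    rw [div_eq_mul_one_div, ← integral_eq_inv_mul_choose, ← integral_const_mul]
    congr 1
    funext z
    rw [mul_pow, mul_pow, ← pow_mul]
    ring
  simp_rw [hterm]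
  have hmem : ∀ {z : ℝ}, z ∈ Set.uIoc (0 : ℝ) 1 → z ∈ Set.Icc (0 : ℝ) 1 := by
    intro z hz
    rw [Set.uIoc_of_le zero_le_one] at hz
    exact ⟨hz.1.le, hz.2⟩
  refine hasSum_integral_of_dominated_convergence (fun k _ => |x| * r ^ k) ?_ ?_ ?_ ?_ ?_
  · intro k
    apply Continuous.aestronglyMeasurable
    fun_prop
  · intro k
    refine Filter.Eventually.of_forall fun z hz => ?_
    have h := hmem hz
    rw [norm_mul, norm_mul, norm_pow, norm_pow, Real.norm_eq_abs, Real.norm_eq_abs,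
      Real.norm_eq_abs]
    have h1 : |z| ^ 2 ≤ 1 := by
      rw [sq_abs]; nlinarith [h.1, h.2]
    have h2 : |x| * |z| ^ 2 ≤ |x| := mul_le_of_le_one_right (abs_nonneg x) h1
    have h3 : |x * (z ^ 2 * (1 - z))| ^ k ≤ r ^ k :=
      pow_le_pow_left₀ (abs_nonneg _) (abs_mul_sq_mul_one_sub_le h) k
    exact mul_le_mul h2 h3 (by positivity) (abs_nonneg x)
  · exact Filter.Eventually.of_forall fun z _ =>
      (summable_geometric_of_lt_one hr0 hr1).mul_left _
  · exact intervalIntegrable_const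
  · refine Filter.Eventually.of_forall fun z hz => ?_
    have h := abs_mul_sq_mul_one_sub_le (x := x) (hmem hz)
    rw [div_eq_mul_inv]
    exact (hasSum_geometric_of_abs_lt_one (h.trans_lt hr1)).mul_left _

/-! ### Evaluation of the integral -/

/-- The difference of arctangents produced by the integral is a triple arctangent. -/
theorem arctan_sub_arctan_eq {t : ℝ} (ht : |t| < 1) :
    arctan ((1 + 4 * t + t ^ 2) / (√3 * (1 - t ^ 2))) - arctan ((1 - t) / (√3 * (1 + t))) =
      3 * arctan (√3 * t / (2 + t)) := by
  have h3 : √3 ^ 2 = (3 : ℝ) := Real.sq_sqrt (by norm_num)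
  have h3p : 0 < √3 := by positivity
  -- The difference of the two sides has zero derivative on (-1, 1), where all denominators are
  -- positive, and it vanishes at 0.
  let f : ℝ → ℝ := fun t => arctan ((1 + 4 * t + t ^ 2) / (√3 * (1 - t ^ 2))) -
    arctan ((1 - t) / (√3 * (1 + t))) - 3 * arctan (√3 * t / (2 + t))
  have hd : ∀ s ∈ Set.Ioo (-1 : ℝ) 1, HasDerivAt f 0 s := by
    intro s hs
    have e1 : 0 < 1 - s ^ 2 := by nlinarith [hs.1, hs.2]
    have e2 : 0 < 1 + s := by linarith [hs.1]
    have e3 : 0 < 2 + s := by linarith [hs.1]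
    have d1 : HasDerivAt (fun t : ℝ => 1 + 4 * t + t ^ 2) (4 + 2 * s) s := by
      convert! (((hasDerivAt_id s).const_mul 4).const_add 1).add (hasDerivAt_pow 2 s) using 1
      simp
    have d2 : HasDerivAt (fun t : ℝ => √3 * (1 - t ^ 2)) (√3 * (-(2 * s))) s := by
      convert! ((hasDerivAt_pow 2 s).const_sub 1).const_mul (√3) using 1
      simp
    have d3 : HasDerivAt (fun t : ℝ => 1 - t) (-1) s := (hasDerivAt_id s).const_sub 1
    have d4 : HasDerivAt (fun t : ℝ => √3 * (1 + t)) (√3 * 1) s :=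
      ((hasDerivAt_id s).const_add 1).const_mul (√3)
    have d5 : HasDerivAt (fun t : ℝ => √3 * t) (√3 * 1) s := (hasDerivAt_id s).const_mul (√3)
    have d6 : HasDerivAt (fun t : ℝ => 2 + t) 1 s := (hasDerivAt_id s).const_add 2
    have D := (((d1.fun_div d2 (by positivity)).arctan).sub
      ((d3.fun_div d4 (by positivity)).arctan)).sub (((d5.fun_div d6 e3.ne').arctan).const_mul 3)
    refine D.congr_deriv ?_
    have g1 : 1 + ((1 + 4 * s + s ^ 2) / (√3 * (1 - s ^ 2))) ^ 2 =
        4 * (1 + s + s ^ 2) ^ 2 / (3 * (1 - s ^ 2) ^ 2) := by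
      rw [div_pow, mul_pow, h3]; field_simp; ring
    have g2 : 1 + ((1 - s) / (√3 * (1 + s))) ^ 2 =
        4 * (1 + s + s ^ 2) / (3 * (1 + s) ^ 2) := by
      rw [div_pow, mul_pow, h3]; field_simp; ring
    have g3 : 1 + (√3 * s / (2 + s)) ^ 2 = 4 * (1 + s + s ^ 2) / (2 + s) ^ 2 := by
      rw [div_pow, mul_pow, h3]; field_simp; ring
    have e4 : 0 < 1 + s + s ^ 2 := by nlinarith [sq_nonneg (s + 1 / 2)]
    rw [g1, g2, g3, mul_pow, mul_pow, h3]
    field_simp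
    ring
  have hconst : ∀ s ∈ Set.Ioo (-1 : ℝ) 1, f s = f 0 := by
    intro s hs
    refine (convex_Ioo (-1 : ℝ) 1).is_const_of_fderivWithin_eq_zero (𝕜 := ℝ) (f := f) ?_ ?_ hs
      (by norm_num)
    · exact fun s hs => (hd s hs).differentiableAt.differentiableWithinAt
    · intro s hs
      rw [fderivWithin_of_isOpen isOpen_Ioo hs]
      ext
      simpa using (hd s hs).deriv
  have := hconst t (abs_lt.mp ht)
  simp only [f] at this
  simp at this
  linarith

/-- The closed form of the series, in terms of the cube root parameter. -/
noncomputable def closedForm (t : ℝ) : ℝ :=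
  2 * √3 * (t * (1 - t) / (1 + t ^ 3)) * arctan (√3 * t / (2 + t)) -
    t / (t ^ 2 - t + 1) * log ((1 - t ^ 3) / (1 - t) ^ 3)

/-- With w = 3tz/(1-t³) the left side is 1 + 3tw² - (1-t³)w³, which is A³ + B³ + C³ - 3ABC for A =
1, B = -w, C = tw; hence the factor A + B + C. -/
theorem one_sub_cubic_eq {t : ℝ} (ht : 1 - t ^ 3 ≠ 0) (z : ℝ) :
    1 - -27 * t ^ 3 / (1 - t ^ 3) ^ 2 * (z ^ 2 * (1 - z)) =
      (1 - (1 - t) * (3 * t / (1 - t ^ 3) * z)) *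
        (1 + (1 - t) * (3 * t / (1 - t ^ 3) * z) +
          (1 + t + t ^ 2) * (3 * t / (1 - t ^ 3) * z) ^ 2) := by
  field_simp
  ring

theorem integral_eq_closedForm {t : ℝ} (ht : |t| < 1) (h : 4 * |t| ^ 3 < (1 - t ^ 3) ^ 2) :
    ∫ z in (0 : ℝ)..1, -27 * t ^ 3 / (1 - t ^ 3) ^ 2 * z ^ 2 /
      (1 - -27 * t ^ 3 / (1 - t ^ 3) ^ 2 * (z ^ 2 * (1 - z))) = closedForm t := by
  have h3 : √3 ^ 2 = (3 : ℝ) := Real.sq_sqrt (by norm_num)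
  have h3p : 0 < √3 := by positivity
  obtain ⟨hl, hr⟩ := abs_lt.mp ht
  have p1 : 0 < 1 + t := by linarith
  have p2 : 0 < 1 - t := by linarith
  have pP : 0 < 1 + t + t ^ 2 := by nlinarith [sq_nonneg (t + 1 / 2)]
  have pN : 0 < t ^ 2 - t + 1 := by nlinarith [sq_nonneg (t - 1 / 2)]
  have hc : 1 - t ^ 3 = (1 - t) * (1 + t + t ^ 2) := by ring
  have pc : 0 < 1 - t ^ 3 := by rw [hc]; positivity
  set x := -27 * t ^ 3 / (1 - t ^ 3) ^ 2 with hx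
  set κ := 3 * t / (1 - t ^ 3) with hκ
  have hxa : 4 * |x| < 27 := by
    rw [hx, abs_div, abs_mul, abs_pow, abs_of_pos (by positivity : 0 < (1 - t ^ 3) ^ 2),
      ← mul_div_assoc, div_lt_iff₀ (by positivity)]
    norm_num
    linarith
  have hD : ∀ z ∈ Set.Icc (0 : ℝ) 1, 0 < 1 - x * (z ^ 2 * (1 - z)) := by
    intro z hz
    have := (le_abs_self _).trans (abs_mul_sq_mul_one_sub_le (x := x) hz)
    linarith
  have hQ : ∀ w : ℝ, 0 < 1 + (1 - t) * w + (1 + t + t ^ 2) * w ^ 2 := by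
    intro w
    have e : 4 * (1 + t + t ^ 2) * (1 + (1 - t) * w + (1 + t + t ^ 2) * w ^ 2) =
        (2 * (1 + t + t ^ 2) * w + (1 - t)) ^ 2 + 3 * (1 + t) ^ 2 := by ring
    have : 0 < 4 * (1 + t + t ^ 2) * (1 + (1 - t) * w + (1 + t + t ^ 2) * w ^ 2) := by
      rw [e]; positivity
    exact pos_of_mul_pos_right this (by positivity)
  have hfac : ∀ z, 1 - x * (z ^ 2 * (1 - z)) = (1 - (1 - t) * (κ * z)) *
      (1 + (1 - t) * (κ * z) + (1 + t + t ^ 2) * (κ * z) ^ 2) := one_sub_cubic_eq pc.ne'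
  have hlin : ∀ z ∈ Set.Icc (0 : ℝ) 1, 0 < 1 - (1 - t) * (κ * z) := by
    intro z hz
    have := hD z hz
    rw [hfac] at this
    exact pos_of_mul_pos_left this (hQ _).le
  -- Antiderivative by partial fractions in w = κz, over the linear and the quadratic factor.
  let Φ : ℝ → ℝ := fun z =>
    (1 / 3 + 2 * t / (3 * (t ^ 2 - t + 1))) * log (1 - (1 - t) * (κ * z)) +
    (1 / 3 - t / (3 * (t ^ 2 - t + 1))) *
      log (1 + (1 - t) * (κ * z) + (1 + t + t ^ 2) * (κ * z) ^ 2) +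
    2 * t * (1 - t) / (√3 * (t ^ 2 - t + 1) * (1 + t)) *
      arctan ((2 * (1 + t + t ^ 2) * (κ * z) + (1 - t)) / (√3 * (1 + t)))
  have hderiv : ∀ z ∈ Set.uIcc (0 : ℝ) 1,
      HasDerivAt Φ (x * z ^ 2 / (1 - x * (z ^ 2 * (1 - z)))) z := by
    intro z hz
    rw [Set.uIcc_of_le zero_le_one] at hz
    have k0 : HasDerivAt (fun z : ℝ => κ * z) κ z := by
      simpa using (hasDerivAt_id z).const_mul κ
    have k1 : HasDerivAt (fun z : ℝ => 1 - (1 - t) * (κ * z)) (-((1 - t) * κ)) z :=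
      (k0.const_mul (1 - t)).const_sub 1
    have k2 : HasDerivAt (fun z : ℝ => 1 + (1 - t) * (κ * z) + (1 + t + t ^ 2) * (κ * z) ^ 2)
        ((1 - t) * κ + (1 + t + t ^ 2) * (2 * (κ * z) * κ)) z := by
      have := ((k0.const_mul (1 - t)).const_add 1).fun_add
        ((k0.fun_pow 2).const_mul (1 + t + t ^ 2))
      simpa using this
    have k3 : HasDerivAt
        (fun z : ℝ => (2 * (1 + t + t ^ 2) * (κ * z) + (1 - t)) / (√3 * (1 + t)))
        (2 * (1 + t + t ^ 2) * κ / (√3 * (1 + t))) z :=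
      ((k0.const_mul (2 * (1 + t + t ^ 2))).add_const (1 - t)).div_const _
    have q1 := hlin z hz
    have q2 := hQ (κ * z)
    have D := (((k1.log q1.ne').const_mul (1 / 3 + 2 * t / (3 * (t ^ 2 - t + 1)))).fun_add
      ((k2.log q2.ne').const_mul (1 / 3 - t / (3 * (t ^ 2 - t + 1))))).fun_add
      (k3.arctan.const_mul (2 * t * (1 - t) / (√3 * (t ^ 2 - t + 1) * (1 + t))))
    refine D.congr_deriv ?_
    rw [hfac]
    have e1 : 1 + ((2 * (1 + t + t ^ 2) * (κ * z) + (1 - t)) / (√3 * (1 + t))) ^ 2 =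
        4 * (1 + t + t ^ 2) * (1 + (1 - t) * (κ * z) + (1 + t + t ^ 2) * (κ * z) ^ 2) /
          (3 * (1 + t) ^ 2) := by
      rw [div_pow, mul_pow, h3]; field_simp; ring
    have e2 : x * z ^ 2 = -((1 - t ^ 3) * κ * (κ * z) ^ 2) := by
      rw [hx, hκ]; field_simp; ring
    rw [e1, e2]
    generalize κ * z = w at q1 q2 ⊢
    obtain ⟨R, hR⟩ : ∃ R, R = 1 + (1 - t) * w + (1 + t + t ^ 2) * w ^ 2 := ⟨_, rfl⟩
    obtain ⟨l, hl'⟩ : ∃ l, l = 1 - (1 - t) * w := ⟨_, rfl⟩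
    obtain ⟨N, hN⟩ : ∃ N, N = t ^ 2 - t + 1 := ⟨_, rfl⟩
    obtain ⟨P, hP⟩ : ∃ P, P = 1 + t + t ^ 2 := ⟨_, rfl⟩
    rw [← hN] at pN
    rw [← hP] at pP
    rw [← hR] at q2
    rw [← hl'] at q1
    rw [← hN, ← hl', ← hR, ← hP]
    have e3 : 2 * t * (1 - t) / (√3 * N * (1 + t)) *
        (1 / (4 * P * R / (3 * (1 + t) ^ 2)) * (2 * P * κ / (√3 * (1 + t)))) =
        t * (1 - t) * κ / (N * R) := by
      clear_value κ
      field_simp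
      linear_combination (-4 * t * κ) * h3
    rw [e3]
    field_simp
    subst hR hl' hN hP
    ring
  have hint : IntervalIntegrable (fun z => x * z ^ 2 / (1 - x * (z ^ 2 * (1 - z))))
      MeasureTheory.volume 0 1 := by
    apply ContinuousOn.intervalIntegrable
    refine ContinuousOn.div (by fun_prop) (by fun_prop) fun z hz => ?_
    rw [Set.uIcc_of_le zero_le_one] at hz
    exact (hD z hz).ne'
  rw [integral_eq_sub_of_hasDerivAt hderiv hint]
  -- At z = 1 the cubic equals 1, so its two factors are mutually inverse and the two logarithms
  -- merge into one.
  have v1 : 1 - (1 - t) * (κ * 1) = (1 - t) ^ 2 / (1 + t + t ^ 2) := by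
    rw [hκ, hc]; field_simp; ring
  have v2 : 1 + (1 - t) * (κ * 1) + (1 + t + t ^ 2) * (κ * 1) ^ 2 =
      ((1 - t) ^ 2 / (1 + t + t ^ 2))⁻¹ := by
    rw [hκ, hc]; field_simp; ring
  have v3 : (2 * (1 + t + t ^ 2) * (κ * 1) + (1 - t)) / (√3 * (1 + t)) =
      (1 + 4 * t + t ^ 2) / (√3 * (1 - t ^ 2)) := by
    have : 1 - t ^ 2 = (1 - t) * (1 + t) := by ring
    rw [this, hκ, hc]; field_simp; ring
  have v4 : (1 - t ^ 3) / (1 - t) ^ 3 = ((1 - t) ^ 2 / (1 + t + t ^ 2))⁻¹ := by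
    rw [hc]; field_simp
  have v5 : 2 * √3 * (t * (1 - t) / (1 + t ^ 3)) =
      3 * (2 * t * (1 - t) / (√3 * (t ^ 2 - t + 1) * (1 + t))) := by
    have : 1 + t ^ 3 = (t ^ 2 - t + 1) * (1 + t) := by ring
    rw [this]
    generalize t ^ 2 - t + 1 = N at pN
    field_simp
    linear_combination t * h3
  have v6 : arctan ((1 - t) / (√3 * (1 + t))) =
      arctan ((1 + 4 * t + t ^ 2) / (√3 * (1 - t ^ 2))) - 3 * arctan (√3 * t / (2 + t)) := by
    linarith [arctan_sub_arctan_eq ht]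
  simp only [Φ, closedForm, v1, v2, v3, v4, v5, log_inv, mul_zero, sub_zero, add_zero, zero_add,
    log_one, ne_eq, OfNat.ofNat_ne_zero, not_false_eq_true, zero_pow, v6]
  field_simp
  ring

/-- Evaluation of `∑ x ^ k / (k * binom(3k, k))` at `x = -27 t³ / (1 - t³)²`. -/
theorem hasSum_closedForm {t : ℝ} (ht : |t| < 1) (h : 4 * |t| ^ 3 < (1 - t ^ 3) ^ 2) :
    HasSum (fun k : ℕ => (-27 * t ^ 3 / (1 - t ^ 3) ^ 2) ^ (k + 1) /
      (((k + 1 : ℕ) : ℝ) * ((3 * (k + 1)).choose (k + 1) : ℝ))) (closedForm t) := by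
  rw [← integral_eq_closedForm ht h]
  apply hasSum_integral
  have p : 0 < (1 - t ^ 3) ^ 2 := lt_of_le_of_lt (by positivity) h
  rw [abs_div, abs_mul, abs_pow, abs_of_pos p, ← mul_div_assoc, div_lt_iff₀ p]
  norm_num
  linarith

/-! ### Real cube roots and the closed form at a ratio -/

theorem cbrt_pow_three (x : ℝ) : cbrt x ^ 3 = x := by
  unfold cbrt
  split_ifs with h
  · rw [← rpow_natCast, ← rpow_mul h]; norm_num
  · have h' : 0 ≤ -x := by linarith
    rw [Odd.neg_pow (by decide), ← rpow_natCast, ← rpow_mul h']; norm_num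

theorem cbrt_eq_of_pow_three {x y : ℝ} (h : y ^ 3 = x) : cbrt x = y :=
  (Odd.strictMono_pow (by decide : Odd 3)).injective (by simpa [h] using cbrt_pow_three x)

theorem cbrt_mul (x y : ℝ) : cbrt (x * y) = cbrt x * cbrt y :=
  cbrt_eq_of_pow_three (by rw [mul_pow, cbrt_pow_three, cbrt_pow_three])

theorem cbrt_ne_zero {x : ℝ} (h : x ≠ 0) : cbrt x ≠ 0 := by
  intro h0
  have := cbrt_pow_three x
  rw [h0] at this
  exact h (by simpa using this.symm)

theorem neg_one_zpow_eq_or (n : ℤ) : (-1 : ℝ) ^ n = 1 ∨ (-1 : ℝ) ^ n = -1 :=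
  n.even_or_odd.imp Even.neg_one_zpow Odd.neg_one_zpow

theorem cbrt_neg_one_zpow (n : ℤ) : cbrt ((-1) ^ n) = (-1) ^ n := by
  apply cbrt_eq_of_pow_three
  rcases neg_one_zpow_eq_or n with h | h <;> rw [h] <;> norm_num

/-- The closed form at a ratio `b / a` of cube roots. -/
theorem closedForm_div {a b : ℝ} (h : |b| < |a|) :
    closedForm (b / a) =
      2 * √3 * (a * b * (a - b) / (a ^ 3 + b ^ 3)) * arctan (√3 * b / (2 * a + b)) -
        a * b * (a + b) / (a ^ 3 + b ^ 3) * log ((b ^ 3 - a ^ 3) / (b - a) ^ 3) := by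
  have ha : a ≠ 0 := abs_pos.mp ((abs_nonneg b).trans_lt h)
  have h2 : b ^ 2 < a ^ 2 := sq_lt_sq.mpr h
  have n1 : a + b ≠ 0 := fun e => by
    rw [eq_neg_of_add_eq_zero_left e] at h2; simp at h2
  have n2 : a - b ≠ 0 := fun e => by rw [sub_eq_zero.mp e] at h2; simp at h2
  have n2' : b - a ≠ 0 := fun e => n2 (by linarith)
  have n3 : 2 * a + b ≠ 0 := fun e => by
    rw [show b = -(2 * a) by linarith] at h2; nlinarith [sq_nonneg a]
  have pN : 0 < a ^ 2 - a * b + b ^ 2 := by nlinarith [sq_nonneg (a - b), sq_nonneg (a + b)]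
  have e1 : √3 * (b / a) / (2 + b / a) = √3 * b / (2 * a + b) := by field_simp
  have e2 : (1 - (b / a) ^ 3) / (1 - b / a) ^ 3 = (b ^ 3 - a ^ 3) / (b - a) ^ 3 := by
    have : 1 - b / a = -(b - a) / a := by field_simp; ring
    rw [this]; field_simp; ring
  have e4 : a ^ 3 + b ^ 3 = (a + b) * (a ^ 2 - a * b + b ^ 2) := by ring
  have e5 : b / a * (1 - b / a) / (1 + (b / a) ^ 3) = a * b * (a - b) / (a ^ 3 + b ^ 3) := by
    have : 1 + (b / a) ^ 3 = (a ^ 3 + b ^ 3) / a ^ 3 := by field_simp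
    have n : a ^ 3 + b ^ 3 ≠ 0 := by rw [e4]; exact mul_ne_zero n1 pN.ne'
    rw [this]; field_simp
  have e6 : b / a / ((b / a) ^ 2 - b / a + 1) = a * b * (a + b) / (a ^ 3 + b ^ 3) := by
    have : (b / a) ^ 2 - b / a + 1 = (a ^ 2 - a * b + b ^ 2) / a ^ 2 := by field_simp; ring
    rw [this, e4]
    generalize a ^ 2 - a * b + b ^ 2 = N at pN
    field_simp
  rw [closedForm, e1, e2, e5, e6]

/-! ### Binet formulas and size estimates -/

theorem lucasNat_eq (n : ℕ) : (lucasNat n : ℝ) = φ ^ n + ψ ^ n := by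
  induction n using Nat.twoStepInduction with
  | zero => norm_num [lucasNat]
  | one => simp [lucasNat, goldenRatio_add_goldenConj]
  | more n h0 h1 =>
    rw [lucasNat, Int.cast_add, h0, h1]
    linear_combination -φ ^ n * goldenRatio_sq - ψ ^ n * goldenConj_sq

theorem lucas_eq (n : ℤ) : (lucas n : ℝ) = φ ^ n + ψ ^ n := by
  cases n with
  | ofNat n => simp [lucas, lucasNat_eq]
  | negSucc n =>
    rw [lucas, zpow_negSucc, zpow_negSucc, ← inv_pow, ← inv_pow, inv_goldenRatio, inv_goldenConj]
    push_cast
    rw [lucasNat_eq, neg_pow φ, neg_pow ψ]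
    ring

theorem fib_add_sub_goldenRatio_zpow_mul (p q : ℤ) :
    (Int.fib (p + q) : ℝ) - φ ^ q * Int.fib p = ψ ^ p * Int.fib q := by
  rw [coe_intFib_eq, coe_intFib_eq, coe_intFib_eq, zpow_add₀ goldenRatio_ne_zero,
    zpow_add₀ goldenConj_ne_zero]
  ring

theorem fib_add_sub_goldenConj_zpow_mul (p q : ℤ) :
    (Int.fib (p + q) : ℝ) - ψ ^ q * Int.fib p = φ ^ p * Int.fib q := by
  rw [coe_intFib_eq, coe_intFib_eq, coe_intFib_eq, zpow_add₀ goldenRatio_ne_zero,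
    zpow_add₀ goldenConj_ne_zero]
  ring

/-- For n ≥ 1, φ^n = φ F_n + F_{n-1}, and the last term is nonnegative. -/
theorem goldenRatio_mul_fib_le (n : ℕ) : φ * n.fib ≤ φ ^ n := by
  cases n with
  | zero => simp
  | succ n =>
    have := goldenRatio_mul_fib_succ_add_fib n
    have h : (0 : ℝ) ≤ n.fib := by positivity
    linarith

/-- The cubes of the parameters satisfy the convergence conditions. -/
theorem fib_ratio_bounds {k l : ℕ} (hk : 2 ≤ k) {c : ℝ}
    (hc : c = (-1) ^ (k + 1) * (l.fib / (φ ^ (k + l) * k.fib))) :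
    |c| < 1 ∧ 4 * |c| < (1 - c) ^ 2 := by
  have hφ := goldenRatio_pos
  have hφ1 := one_lt_goldenRatio
  have hF : (1 : ℝ) ≤ k.fib := by exact_mod_cast Nat.fib_pos.mpr (by omega)
  set d := (l.fib : ℝ) / (φ ^ (k + l) * k.fib) with hd
  have hd0 : 0 ≤ d := by positivity
  have hd1 : d ≤ 1 / (φ ^ (k + 1) * k.fib) := by
    rw [hd, div_le_div_iff₀ (by positivity) (by positivity), one_mul]
    have := mul_le_mul_of_nonneg_right (goldenRatio_mul_fib_le l)
      (by positivity : 0 ≤ φ ^ k * k.fib)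
    calc _ = φ * l.fib * (φ ^ k * k.fib) := by ring
      _ ≤ _ := this
      _ = _ := by ring
  have habs : |c| = d := by
    rw [hc, abs_mul, abs_pow, abs_neg, abs_one, one_pow, one_mul, abs_of_nonneg hd0]
  have hlt : d < 1 := by
    refine hd1.trans_lt ?_
    rw [div_lt_one (by positivity)]
    have : 1 < φ ^ (k + 1) := one_lt_pow₀ hφ1 (by omega)
    nlinarith
  refine ⟨habs ▸ hlt, ?_⟩
  rw [habs]
  -- For k = 2 size alone is not enough, but the sign gives c = -d and (1+d)² - 4d = (1-d)² > 0. For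
  -- k ≥ 3, φ⁴ > 5 and F_k ≥ 2 give d ≤ 1/10, which suffices for either sign.
  obtain rfl | hk3 := hk.eq_or_lt
  · have e : (1 - c) ^ 2 = (1 - d) ^ 2 + 4 * d := by rw [hc]; ring
    rw [e]
    linarith [pow_pos (sub_pos.mpr hlt) 2]
  · have h4 : φ ^ 4 ≤ φ ^ (k + 1) := pow_le_pow_right₀ hφ1.le (by omega)
    have h5 : φ ^ 4 = 3 * φ + 2 := by
      linear_combination (φ ^ 2 + φ + 2) * goldenRatio_sq
    have hF2 : (2 : ℝ) ≤ k.fib := by exact_mod_cast Nat.fib_mono hk3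
    have h6 : d ≤ 1 / 10 := by
      refine hd1.trans (one_div_le_one_div_of_le (by norm_num) ?_)
      nlinarith
    have hcd : c ≤ d := habs ▸ le_abs_self c
    nlinarith

/-! ### The series along powers of φ and of ψ -/

/-- The series along powers of `s`, when the argument has a cube root parameter. -/
theorem hasSum_coeff_mul_zpow {p q : ℤ} {s t : ℝ}
    (hc : |t ^ 3| < 1 ∧ 4 * |t ^ 3| < (1 - t ^ 3) ^ 2)
    (hx : -27 * (Int.fib p : ℝ) * (Int.fib (p + q) : ℝ) / (Int.fib q : ℝ) ^ 2 * s ^ (2 * p + q) =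
      -27 * t ^ 3 / (1 - t ^ 3) ^ 2) :
    HasSum (fun k : ℕ => coeff p q (k + 1) * s ^ ((2 * p + q) * ((k + 1 : ℕ) : ℤ)))
      (closedForm t) := by
  rw [abs_pow] at hc
  have ht : |t| < 1 := (pow_lt_one_iff_of_nonneg (abs_nonneg t) (by norm_num)).mp hc.1
  convert! hasSum_closedForm ht hc.2 using 2 with k
  rw [← hx, coeff, zpow_mul, zpow_natCast, mul_pow _ (s ^ (2 * p + q))]
  ring

/-- Sum of the series along powers of the golden ratio. -/
theorem hasSum_coeff_mul_goldenRatio_zpow {p q : ℤ} (hp : p ≤ -2) (hpq : 2 ≤ p + q) :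
    HasSum (fun k : ℕ => coeff p q (k + 1) * φ ^ ((2 * p + q) * ((k + 1 : ℕ) : ℤ)))
      (cbrt ((Int.fib p : ℝ) * Int.fib (p + q)) *
        (2 * √3 * (Aminus p q φ * arctan (√3 * cbrt (Int.fib (p + q)) /
            (2 * cbrt (φ ^ q * Int.fib p) + cbrt (Int.fib (p + q))))) -
          Aplus p q φ * log (ψ ^ p * Int.fib q /
            (cbrt (Int.fib (p + q)) - cbrt (φ ^ q * Int.fib p)) ^ 3))) := by
  have hFp : (Int.fib p : ℝ) ≠ 0 := by
    rw [Ne, Int.cast_eq_zero, Int.fib_eq_zero]; omega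
  have hFpq : (Int.fib (p + q) : ℝ) ≠ 0 := by
    rw [Ne, Int.cast_eq_zero, Int.fib_eq_zero]; omega
  have hFq : (Int.fib q : ℝ) ≠ 0 := by
    rw [Ne, Int.cast_eq_zero, Int.fib_eq_zero]; omega
  have hφ := goldenRatio_ne_zero
  have hψ := goldenConj_ne_zero
  have hu : φ ^ q * Int.fib p ≠ 0 := mul_ne_zero (zpow_ne_zero _ hφ) hFp
  set a := cbrt (φ ^ q * Int.fib p) with ha
  set b := cbrt (Int.fib (p + q)) with hb
  have ha3 : a ^ 3 = φ ^ q * Int.fib p := cbrt_pow_three _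
  have hb3 : b ^ 3 = Int.fib (p + q) := cbrt_pow_three _
  have ha0 : a ≠ 0 := cbrt_ne_zero hu
  have hsub : b ^ 3 - a ^ 3 = ψ ^ p * Int.fib q := by
    rw [ha3, hb3]; exact fib_add_sub_goldenRatio_zpow_mul p q
  -- Here k = -p and l = p + q; the sign comes from F_{-m} = (-1)^(m+1) F_m.
  have hc : |(b / a) ^ 3| < 1 ∧ 4 * |(b / a) ^ 3| < (1 - (b / a) ^ 3) ^ 2 := by
    obtain ⟨m, rfl⟩ : ∃ m : ℕ, p = -(m : ℤ) := ⟨p.natAbs, by omega⟩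
    obtain ⟨n, hn⟩ : ∃ n : ℕ, -(m : ℤ) + q = n := ⟨(-(m : ℤ) + q).natAbs, by omega⟩
    apply fib_ratio_bounds (k := m) (l := n) (by omega)
    rw [div_pow, ha3, hb3, hn, Int.fib_natCast, Int.fib_neg_natCast,
      show q = ((m + n : ℕ) : ℤ) by push_cast; omega, zpow_natCast]
    have : ((-1 : ℝ) ^ (m + 1)) ^ 2 = 1 := by rw [← pow_mul, mul_comm, pow_mul]; simp
    have hm : (m.fib : ℝ) ≠ 0 := by exact_mod_cast (Nat.fib_pos.mpr (by omega)).ne'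
    push_cast
    field_simp
    linear_combination -(n.fib : ℝ) * this
  have hab : |b| < |a| := by
    have := hc.1
    rw [abs_pow, pow_lt_one_iff_of_nonneg (abs_nonneg _) (by norm_num), abs_div,
      div_lt_one (abs_pos.mpr ha0)] at this
    exact this
  have hx : -27 * (Int.fib p : ℝ) * (Int.fib (p + q) : ℝ) / (Int.fib q : ℝ) ^ 2 *
      φ ^ (2 * p + q) = -27 * (b / a) ^ 3 / (1 - (b / a) ^ 3) ^ 2 := by
    have e1 : -27 * (b / a) ^ 3 / (1 - (b / a) ^ 3) ^ 2 =
        -27 * (a ^ 3 * b ^ 3) / (b ^ 3 - a ^ 3) ^ 2 := by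
      have : 1 - (b / a) ^ 3 = -(b ^ 3 - a ^ 3) / a ^ 3 := by field_simp; ring
      rw [this]
      field_simp
    have e2 : φ ^ (2 * p + q) * (ψ ^ p) ^ 2 = φ ^ q := by
      rw [zpow_add₀ hφ, mul_comm 2 p, zpow_mul, mul_right_comm,
        show (φ ^ p) ^ (2 : ℤ) = (φ ^ p) ^ 2 from zpow_natCast _ 2, ← mul_pow, ← mul_zpow,
        goldenRatio_mul_goldenConj]
      rcases neg_one_zpow_eq_or p with h | h <;> rw [h] <;> norm_num
    rw [e1, hsub, ha3, hb3, ← e2]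
    field_simp
  convert! hasSum_coeff_mul_zpow hc hx using 1
  rw [closedForm_div hab, hsub, Aminus, Aplus, ← ha, ← hb, ← ha3, ← hb3,
    cbrt_mul, hb3, ← hb]
  have hcab : cbrt (φ ^ q) * cbrt (Int.fib p) = a := (cbrt_mul _ _).symm
  rw [← hcab]
  ring

/-- Sum of the series along powers of the conjugate of the golden ratio. -/
theorem hasSum_coeff_mul_goldenConj_zpow {p q : ℤ} (hp : p ≤ -2) (hpq : 2 ≤ p + q) :
    HasSum (fun k : ℕ => coeff p q (k + 1) * ψ ^ ((2 * p + q) * ((k + 1 : ℕ) : ℤ)))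
      (-(cbrt ((Int.fib p : ℝ) * Int.fib (p + q)) *
        (2 * √3 * (Aminus p q ψ * arctan (√3 * cbrt (Int.fib p) /
            (2 * (-1 : ℝ) ^ q * cbrt (φ ^ q * Int.fib (p + q)) + cbrt (Int.fib p)))) +
          Aplus p q ψ * log (φ ^ p * Int.fib q /
            (cbrt (Int.fib (p + q)) - cbrt (ψ ^ q * Int.fib p)) ^ 3)))) := by
  have hFp : (Int.fib p : ℝ) ≠ 0 := by
    rw [Ne, Int.cast_eq_zero, Int.fib_eq_zero]; omega
  have hFpq : (Int.fib (p + q) : ℝ) ≠ 0 := by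
    rw [Ne, Int.cast_eq_zero, Int.fib_eq_zero]; omega
  have hFq : (Int.fib q : ℝ) ≠ 0 := by
    rw [Ne, Int.cast_eq_zero, Int.fib_eq_zero]; omega
  have hφ := goldenRatio_ne_zero
  have hψ := goldenConj_ne_zero
  have hu : ψ ^ q * Int.fib p ≠ 0 := mul_ne_zero (zpow_ne_zero _ hψ) hFp
  set a := cbrt (ψ ^ q * Int.fib p) with ha
  set b := cbrt (Int.fib (p + q)) with hb
  have ha3 : a ^ 3 = ψ ^ q * Int.fib p := cbrt_pow_three _
  have hb3 : b ^ 3 = Int.fib (p + q) := cbrt_pow_three _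
  have hb0 : b ≠ 0 := cbrt_ne_zero hFpq
  have hsub : b ^ 3 - a ^ 3 = φ ^ p * Int.fib q := by
    rw [ha3, hb3]; exact fib_add_sub_goldenConj_zpow_mul p q
  -- Now k = p + q and l = -p: ψ = -1/φ makes a the smaller root in modulus, and the signs combine
  -- to (-1)^(k+1).
  have hc : |(a / b) ^ 3| < 1 ∧ 4 * |(a / b) ^ 3| < (1 - (a / b) ^ 3) ^ 2 := by
    obtain ⟨m, rfl⟩ : ∃ m : ℕ, p = -(m : ℤ) := ⟨p.natAbs, by omega⟩
    obtain ⟨n, hn⟩ : ∃ n : ℕ, -(m : ℤ) + q = n := ⟨(-(m : ℤ) + q).natAbs, by omega⟩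
    apply fib_ratio_bounds (k := n) (l := m) (by omega)
    have hψφ : ψ = -1 * φ⁻¹ := by rw [inv_goldenRatio]; ring
    rw [div_pow, ha3, hb3, hn, Int.fib_natCast, Int.fib_neg_natCast,
      show q = ((m + n : ℕ) : ℤ) by push_cast; omega, zpow_natCast, hψφ, mul_pow, inv_pow]
    have : ((-1 : ℝ) ^ m) ^ 2 = 1 := by rw [← pow_mul, mul_comm, pow_mul]; simp
    have hn0 : (n.fib : ℝ) ≠ 0 := by exact_mod_cast (Nat.fib_pos.mpr (by omega)).ne'
    push_cast
    rw [add_comm n m]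
    field_simp
    rw [pow_add, pow_add, pow_add]
    linear_combination -(m.fib : ℝ) * (-1) ^ n * this
  have hab : |a| < |b| := by
    have := hc.1
    rw [abs_pow, pow_lt_one_iff_of_nonneg (abs_nonneg _) (by norm_num), abs_div,
      div_lt_one (abs_pos.mpr hb0)] at this
    exact this
  have hx : -27 * (Int.fib p : ℝ) * (Int.fib (p + q) : ℝ) / (Int.fib q : ℝ) ^ 2 *
      ψ ^ (2 * p + q) = -27 * (a / b) ^ 3 / (1 - (a / b) ^ 3) ^ 2 := by
    have e1 : -27 * (a / b) ^ 3 / (1 - (a / b) ^ 3) ^ 2 =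
        -27 * (a ^ 3 * b ^ 3) / (b ^ 3 - a ^ 3) ^ 2 := by
      have : 1 - (a / b) ^ 3 = (b ^ 3 - a ^ 3) / b ^ 3 := by field_simp
      rw [this]
      field_simp
    have e2 : ψ ^ (2 * p + q) * (φ ^ p) ^ 2 = ψ ^ q := by
      rw [zpow_add₀ hψ, mul_comm 2 p, zpow_mul, mul_right_comm,
        show (ψ ^ p) ^ (2 : ℤ) = (ψ ^ p) ^ 2 from zpow_natCast _ 2, ← mul_pow, ← mul_zpow,
        goldenConj_mul_goldenRatio]
      rcases neg_one_zpow_eq_or p with h | h <;> rw [h] <;> norm_num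
    rw [e1, hsub, ha3, hb3, ← e2]
    field_simp
  have hlog : (a ^ 3 - b ^ 3) / (a - b) ^ 3 = (b ^ 3 - a ^ 3) / (b - a) ^ 3 := by
    rw [← neg_sub (b ^ 3), ← neg_sub b a, Odd.neg_pow (by decide), neg_div_neg_eq]
  have hcab : cbrt (ψ ^ q) * cbrt (Int.fib p) = a := (cbrt_mul _ _).symm
  -- Scaling numerator and denominator by the cube root of ψ^q, with φψ = -1, turns the stated
  -- argument into the one for t = a/b.
  have hatan : √3 * cbrt (Int.fib p) / (2 * (-1 : ℝ) ^ q * cbrt (φ ^ q * Int.fib (p + q)) +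
      cbrt (Int.fib p)) = √3 * a / (2 * b + a) := by
    have e : cbrt (ψ ^ q) ≠ 0 := cbrt_ne_zero (zpow_ne_zero _ hψ)
    have e1 : cbrt (ψ ^ q) * cbrt (φ ^ q) = (-1) ^ q := by
      rw [← cbrt_mul, ← mul_zpow, goldenConj_mul_goldenRatio, cbrt_neg_one_zpow]
    have e2 : ((-1 : ℝ) ^ q) ^ 2 = 1 := by
      rcases neg_one_zpow_eq_or q with h | h <;> rw [h] <;> norm_num
    rw [← mul_div_mul_left _ _ e, cbrt_mul, ← hb, ← hcab]
    congr 1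
    · ring
    · linear_combination (2 * (-1) ^ q * b) * e1 + 2 * b * e2
  -- Swapping a and b negates the factor a - b but not a + b, so only the arctangent term changes
  -- sign relative to the case of φ.
  convert! hasSum_coeff_mul_zpow hc hx using 1
  rw [closedForm_div hab, hatan, hlog, hsub, Aminus, Aplus, ← ha, ← hb, ← ha3, ← hb3,
    cbrt_mul, hb3, ← hb, ← hcab]
  ring

/-! ### Recombination into Fibonacci and Lucas series -/

theorem coeff_mul_fib (p q N : ℤ) (k : ℕ) :
    coeff p q k * (Int.fib N : ℝ) = (coeff p q k * φ ^ N - coeff p q k * ψ ^ N) / √5 := by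
  rw [coe_intFib_eq]
  ring

end FibLucasSeries

theorem theorem9 (p q : ℤ) (hp : p ≤ -2) (hq : 4 ≤ q) (hpq : |p| + 1 < q) :
    (Summable (fun k : ℕ =>
        FibLucasSeries.coeff p q (k + 1) * (Int.fib ((2 * p + q) * ((k + 1 : ℕ) : ℤ)) : ℝ)) ∧
      √5 / FibLucasSeries.cbrt ((Int.fib p : ℝ) * (Int.fib (p + q) : ℝ)) *
          ∑' k : ℕ, FibLucasSeries.coeff p q (k + 1) *
            (Int.fib ((2 * p + q) * ((k + 1 : ℕ) : ℤ)) : ℝ) =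
        2 * √3 *
          (FibLucasSeries.Aminus p q φ *
              Real.arctan (√3 * FibLucasSeries.cbrt (Int.fib (p + q)) /
                (2 * FibLucasSeries.cbrt (φ ^ q * Int.fib p) +
                  FibLucasSeries.cbrt (Int.fib (p + q)))) +
            FibLucasSeries.Aminus p q ψ *
              Real.arctan (√3 * FibLucasSeries.cbrt (Int.fib p) /
                (2 * (-1 : ℝ) ^ q * FibLucasSeries.cbrt (φ ^ q * Int.fib (p + q)) +
                  FibLucasSeries.cbrt (Int.fib p)))) -
        (FibLucasSeries.Aplus p q φ *
            Real.log (ψ ^ p * Int.fib q /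
              (FibLucasSeries.cbrt (Int.fib (p + q)) -
                FibLucasSeries.cbrt (φ ^ q * Int.fib p)) ^ 3) -
          FibLucasSeries.Aplus p q ψ *
            Real.log (φ ^ p * Int.fib q /
              (FibLucasSeries.cbrt (Int.fib (p + q)) -
                FibLucasSeries.cbrt (ψ ^ q * Int.fib p)) ^ 3))) ∧
    (Summable (fun k : ℕ =>
        FibLucasSeries.coeff p q (k + 1) *
          (FibLucasSeries.lucas ((2 * p + q) * ((k + 1 : ℕ) : ℤ)) : ℝ)) ∧
      1 / FibLucasSeries.cbrt ((Int.fib p : ℝ) * (Int.fib (p + q) : ℝ)) *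
          ∑' k : ℕ, FibLucasSeries.coeff p q (k + 1) *
            (FibLucasSeries.lucas ((2 * p + q) * ((k + 1 : ℕ) : ℤ)) : ℝ) =
        2 * √3 *
          (FibLucasSeries.Aminus p q φ *
              Real.arctan (√3 * FibLucasSeries.cbrt (Int.fib (p + q)) /
                (2 * FibLucasSeries.cbrt (φ ^ q * Int.fib p) +
                  FibLucasSeries.cbrt (Int.fib (p + q)))) -
            FibLucasSeries.Aminus p q ψ *
              Real.arctan (√3 * FibLucasSeries.cbrt (Int.fib p) /
                (2 * (-1 : ℝ) ^ q * FibLucasSeries.cbrt (φ ^ q * Int.fib (p + q)) +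
                  FibLucasSeries.cbrt (Int.fib p)))) -
        (FibLucasSeries.Aplus p q φ *
            Real.log (ψ ^ p * Int.fib q /
              (FibLucasSeries.cbrt (Int.fib (p + q)) -
                FibLucasSeries.cbrt (φ ^ q * Int.fib p)) ^ 3) +
          FibLucasSeries.Aplus p q ψ *
            Real.log (φ ^ p * Int.fib q /
              (FibLucasSeries.cbrt (Int.fib (p + q)) -
                FibLucasSeries.cbrt (ψ ^ q * Int.fib p)) ^ 3))) := by
  have hp0 : p < 0 := by omega
  rw [abs_of_neg hp0] at hpq
  have hφ := FibLucasSeries.hasSum_coeff_mul_goldenRatio_zpow hp (by omega : 2 ≤ p + q)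
  have hψ := FibLucasSeries.hasSum_coeff_mul_goldenConj_zpow hp (by omega : 2 ≤ p + q)
  have hg : FibLucasSeries.cbrt ((Int.fib p : ℝ) * (Int.fib (p + q) : ℝ)) ≠ 0 := by
    apply FibLucasSeries.cbrt_ne_zero
    rw [← Int.cast_mul, Ne, Int.cast_eq_zero, mul_eq_zero, Int.fib_eq_zero, Int.fib_eq_zero]
    omega
  have hF := (hφ.sub hψ).div_const √5
  have hL := hφ.add hψ
  simp only [← FibLucasSeries.coeff_mul_fib] at hF
  simp only [← mul_add, ← FibLucasSeries.lucas_eq] at hL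
  -- Summability over ℝ is unconditional, hence absolute.
  refine ⟨⟨hF.summable, ?_⟩, hL.summable, ?_⟩
  · rw [hF.tsum_eq]
    field_simp
    ring
  · rw [hL.tsum_eq]
    rw [one_div, inv_mul_eq_iff_eq_mul₀ hg]
    ring
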